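/- **Setting.** Let $x=(x^1,\dots,x^n)\in\mathbb R^n$ and let $u=(u^1,\dots,u^m)$, $\tilde u=(\tilde u^1,\dots,\tilde u^{\tilde m})$, $v=(v^1,\dots,v^m)$, $\tilde v=(\tilde v^1,\dots,\tilde v^{\tilde m})$ be real dependent variables. A differential function is a smooth real function of $x$ and of finitely many derivatives of the dependent variables (of orders $\ge 0$); $D_{x^i}$ is the total derivative, $D^K=D_{x^1}^{K_1}\cdots D_{x^n}^{K_n}$ for a multi-index $K$, $\operatorname{div}C=\sum_i D_{x^i}C^i$, $e_i$ is the $i$-th unit multi-index, and $\frac{\delta f}{\delta u^j}=\sum_J(-1)^{|J|}D^J\frac{\partial f}{\partial u^j_J}$. For an operator $V=\sum_i\xi^i\partial_{x^i}+\sum_j\phi^j\partial_{u^j}$, whose coefficients are differential functions, put $W^j=\phi^j-\sum_i\xi^iu^j_{x^i}$ and $\operatorname{Pr}V=\sum_i\xi^i\partial_{x^i}+\sum_{j,J}\bigl(D^JW^j+\sum_i\xi^iu^j_{J+e_i}\bigr)\partial_{u^j_J}$. Let $F_1,\dots,F_m$ be differential functions of $x,u,\tilde u$. Consider the system $F_\alpha=0$,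 $\alpha=1,\dots,m$, the formal Lagrangian $$L=\sum_{\beta=1}^m v^\beta F_\beta+\Bigl(\sum_{\gamma=1}^{\tilde m}\tilde v^{\gamma}\Bigr)\Bigl(\sum_{\nu=1}^mF_\nu\Bigr)=\sum_{\beta=1}^m w^\beta F_\beta,\qquad w^\beta=v^\beta+\sum_{\gamma=1}^{\tilde m}\tilde v^\gamma,$$ and the adjoint equations $\frac{\delta L}{\delta u^\alpha}=0$ ($\alpha=1,\dots,m$), $\frac{\delta L}{\delta\tilde u^{\gamma}}=0$ ($\gamma=1,\dots,\tilde m$). Let $$X=\sum_i\xi^i\frac{\partial}{\partial x^i}+\sum_\beta\eta_\beta\frac{\partial}{\partial u^\beta}+\sum_\gamma\tilde\eta_\gamma\frac{\partial}{\partial\tilde u^\gamma},$$ where the coefficients are differential functions of $x,u,\tilde u$, and for differential functions $\eta^\star_\beta,\tilde\eta^\star_\gamma$ of $x,u,\tilde u,v,\tilde v$ put $Y=X+\sum_\beta\eta^\star_\beta\frac{\partial}{\partial v^\beta}+\sum_\gamma\tilde\eta^\star_\gamma\frac{\partial}{\partial\tilde v^\gamma}$. For differential functions $B=(B^1,\dots,B^n)$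 of $x,u,\tilde u,v,\tilde v$ let $C=C[Y,B]$ be Noether's vector $$C^i=-B^i+\xi^iL+\sum_{j}\sum_{k,l}\frac{\binom{|k|}{k}\binom{|l|}{l}}{\binom{|k+l+e_i|}{k+l+e_i}}\;D^k(W^j)\;(-1)^{|l|}D^l\Bigl(\frac{\partial L}{\partial u^j_{k+l+e_i}}\Bigr),$$ where $j$ runs over all $2(m+\tilde m)$ dependent variables $(u,\tilde u,v,\tilde v)$, $W^j$ is formed with $Y$, $k,l$ run over multi-indices and $\binom{|k|}{k}=\frac{|k|!}{k_1!\cdots k_n!}$. A vector of differential functions is called conserved if its divergence vanishes on every smooth solution $(u,\tilde u,v,\tilde v)$, on any open set $\Omega\subseteq\mathbb R^n$, of the system $F_\alpha=0$ together with its adjoint equations. **Theorem.** Every infinitesimal generator or Lie–Bäcklund operator $X$ of the system provides a conservation law for the system together with its adjoint equations. Precisely: (1) *Point symmetries.* Suppose that $\xi^i,\eta_\beta,\tilde\eta_\gamma$ depend on $x,u,\tilde u$ only (not on derivatives) and that $\operatorname{Pr}X(F_\alpha)=\sum_\beta\lambda_{\alpha\beta}F_\beta$ for differential functions $\lambda_{\alpha\beta}$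 of $x,u,\tilde u$. The condition $$\eta^\star_\beta+\sum_\gamma\tilde\eta^\star_\gamma=-\Bigl[\sum_\alpha v^\alpha\lambda_{\alpha\beta}+v^\beta\operatorname{div}\xi+\Bigl(\sum_\gamma\tilde v^\gamma\Bigr)\sum_\alpha\lambda_{\alpha\beta}+\Bigl(\sum_\gamma\tilde v^\gamma\Bigr)\operatorname{div}\xi\Bigr]\qquad(\beta=1,\dots,m)$$ is satisfied by $\eta^\star_\beta=-\bigl[\sum_\alpha w^\alpha\lambda_{\alpha\beta}+v^\beta\operatorname{div}\xi\bigr]$, $\tilde\eta^\star_\gamma=-\tilde v^\gamma\operatorname{div}\xi$. For all differential functions $\eta^\star,\tilde\eta^\star$ that satisfy it, $\operatorname{Pr}Y(L)+L\operatorname{div}\xi=0$; and whenever $\operatorname{Pr}Y(L)+L\operatorname{div}\xi=\operatorname{div}B$ (in particular for $B=0$), the vector $C[Y,B]$ is conserved. (2) *Lie–Bäcklund symmetries.* Suppose that $\operatorname{Pr}X(F_\nu)=\sum_\mu\mathcal D_{\nu\mu}(F_\mu)$ for differential operators $\mathcal D_{\nu\mu}=\sum_K\lambda^K_{\nu\mu}D^K$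 (finite sums, whose coefficients are differential functions of $x,u,\tilde u$). There are differential functions $\eta^\star,\tilde\eta^\star$ with $$\eta^\star_\beta+\sum_\gamma\tilde\eta^\star_\gamma=-\Bigl[w^\beta\operatorname{div}\xi+\sum_\mu\sum_K(-1)^{|K|}D^K\bigl(w^\mu\lambda^K_{\mu\beta}\bigr)\Bigr]\qquad(\beta=1,\dots,m).$$ For all such $\eta^\star,\tilde\eta^\star$ there are differential functions $B^1,\dots,B^n$ with $\operatorname{Pr}Y(L)+L\operatorname{div}\xi=\operatorname{div}B$, and for every such $B$ the vector $C[Y,B]$ is conserved. -/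

import Mathlib

open scoped ContDiff

noncomputable section

namespace Jets

/-! ### Jet space, differential functions, total derivatives -/

/-- Coordinates on the infinite jet space with `n` independent variables and dependent variables
indexed by `ι`: `Sum.inl i` is `x^i`, and `Sum.inr (j, J)` is the derivative `u^j_J`, where the
multi-index `J` says how many times one differentiates with respect to each `x^i`. -/
abbrev Coord (n : ℕ) (ι : Type) : Type := Fin n ⊕ ι × (Fin n → ℕ)

/-- Points of the infinite jet space. -/
abbrev Jet (n : ℕ) (ι : Type) : Type := Coord n ι → ℝ

/-- Real functions on the infinite jet space. -/
abbrev JetFn (n : ℕ) (ι : Type) : Type := Jet n ι → ℝ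

variable {n : ℕ} {ι κ : Type}

/-- A differential function: a smooth function of finitely many of the variables
`x^i`, `u^j_J`. -/
def IsDifferential (f : JetFn n ι) : Prop :=
  ∃ (S : Finset (Coord n ι)) (g : (S → ℝ) → ℝ), ContDiff ℝ ∞ g ∧ ∀ z, f z = g (fun c => z c)

/-- The coordinate function `u^j_J`. -/
def dep (j : ι) (J : Fin n → ℕ) : JetFn n ι := fun z => z (Sum.inr (j, J))

open Classical in
/-- The partial derivative of `f` with respect to the jet coordinate `c`. -/
def pd (c : Coord n ι) (f : JetFn n ι) : JetFn n ι :=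
  fun z => deriv (fun t => f (Function.update z c t)) (z c)

/-- The total derivative `D_{x^i} f = ∂f/∂x^i + ∑_{j,J} u^j_{J+e_i} ∂f/∂u^j_J`. -/
def D (i : Fin n) (f : JetFn n ι) : JetFn n ι := fun z =>
  pd (Sum.inl i) f z
    + ∑ᶠ p : ι × (Fin n → ℕ), z (Sum.inr (p.1, p.2 + Pi.single i 1)) * pd (Sum.inr p) f z

/-- `T_1^{J_1} ∘ ⋯ ∘ T_n^{J_n}`. -/
def multi {A : Type} (T : Fin n → A → A) (J : Fin n → ℕ) (a : A) : A :=
  (List.finRange n).foldr (fun i b => (T i)^[J i] b) a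

/-- `D^J = D_{x^1}^{J_1} ⋯ D_{x^n}^{J_n}`. -/
def DD (J : Fin n → ℕ) (f : JetFn n ι) : JetFn n ι := multi D J f

/-- The order `|J|` of a multi-index. -/
def ord (J : Fin n → ℕ) : ℕ := ∑ i, J i

/-- The total divergence `D_{x^1} C^1 + ⋯ + D_{x^n} C^n`. -/
def tdiv (C : Fin n → JetFn n ι) : JetFn n ι := fun z => ∑ i, D i (C i) z

/-- The variational derivative `δf/δu^j = ∑_J (-1)^{|J|} D^J (∂f/∂u^j_J)`. -/
def euler (j : ι) (f : JetFn n ι) : JetFn n ι := fun z =>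
  ∑ᶠ J : Fin n → ℕ, (-1) ^ ord J * DD J (pd (Sum.inr (j, J)) f) z

/-! ### Jets of functions -/

/-- The partial derivative `∂f/∂x^i` of a function on `ℝⁿ`. -/
def spd (i : Fin n) (f : (Fin n → ℝ) → ℝ) : (Fin n → ℝ) → ℝ :=
  fun x => fderiv ℝ f x (Pi.single i 1)

/-- The point of the jet space given by `x` and all partial derivatives of `U` at `x`. -/
def jet (U : (Fin n → ℝ) → ι → ℝ) (x : Fin n → ℝ) : Jet n ι :=
  Sum.elim x (fun p => multi spd p.2 (fun y => U y p.1) x)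

/-! ### Operators and their prolongations -/

/-- An operator `∑ ξ^i ∂/∂x^i + ∑ η^j ∂/∂u^j`. -/
structure GenOp (n : ℕ) (ι : Type) where
  xi : Fin n → JetFn n ι
  eta : ι → JetFn n ι

/-- The coefficients are differential functions (of any order): a Lie-Bäcklund operator. -/
def GenOp.IsDifferential (X : GenOp n ι) : Prop :=
  (∀ i, Jets.IsDifferential (X.xi i)) ∧ ∀ j, Jets.IsDifferential (X.eta j)

/-- The coefficients depend on `x` and on `u` only, not on derivatives of `u`. -/
def GenOp.IsPoint (X : GenOp n ι) : Prop :=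
  (∀ i, DependsOn (X.xi i) (Set.range Sum.inl ∪ Set.range fun j => Sum.inr (j, 0))) ∧
  ∀ j, DependsOn (X.eta j) (Set.range Sum.inl ∪ Set.range fun j => Sum.inr (j, 0))

/-- The characteristic `W^j = η^j - ∑ ξ^i u^j_{x^i}`. -/
def GenOp.W (X : GenOp n ι) (j : ι) : JetFn n ι := fun z =>
  X.eta j z - ∑ i, X.xi i z * dep j (Pi.single i 1) z

/-- The prolongation `Pr X = ∑ ξ^i ∂/∂x^i + ∑_{j,J} (D^J W^j + ∑ ξ^i u^j_{J+e_i}) ∂/∂u^j_J`,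
applied to `f`. -/
def GenOp.pr (X : GenOp n ι) (f : JetFn n ι) : JetFn n ι := fun z =>
  (∑ i, X.xi i z * pd (Sum.inl i) f z)
    + ∑ᶠ p : ι × (Fin n → ℕ),
        (DD p.2 (X.W p.1) z + ∑ i, X.xi i z * dep p.1 (p.2 + Pi.single i 1) z)
          * pd (Sum.inr p) f z

/-! ### Noether's theorem: invariance criterion and conserved vector -/

/-- The infinitesimal (divergence) invariance criterion `Pr V (L) + L div ξ = div B`. -/
def IsDivInvariant (L : JetFn n ι) (V : GenOp n ι) (B : Fin n → JetFn n ι) : Prop :=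
  ∀ z, V.pr L z + L z * tdiv V.xi z = tdiv B z

/-- The weight by which `∂L/∂u_{k+l+e_i}` is shared between the terms of Noether's vector.
It is `1` if `n = 1`; in general it makes the formula in terms of multi-indices equal to the
formula that sums over all ordered tuples of indices and differentiates with respect to the
symmetrized variables `u_{i_1⋯i_r}`. -/
def weight (i : Fin n) (k l : Fin n → ℕ) : ℝ :=
  (Nat.multinomial Finset.univ k * Nat.multinomial Finset.univ l : ℝ)
    / Nat.multinomial Finset.univ (k + l + Pi.single i 1)

/-- Noether's vector: `C^i = -B^i + ξ^i L
  + ∑_j ∑_{k,l} weight(i,k,l) D^k(W^j) (-D)^l (∂L/∂u^j_{k+l+e_i})`. -/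
def noether [Fintype ι] (L : JetFn n ι) (V : GenOp n ι) (B : Fin n → JetFn n ι) :
    Fin n → JetFn n ι := fun i z =>
  -B i z + V.xi i z * L z
    + ∑ j, ∑ᶠ q : (Fin n → ℕ) × (Fin n → ℕ), weight i q.1 q.2 * DD q.1 (V.W j) z
        * ((-1) ^ ord q.2 * DD q.2 (pd (Sum.inr (j, q.1 + q.2 + Pi.single i 1)) L) z)

/-! ### Linear differential operators in the total derivatives -/

/-- A differential operator `∑_K λ^K D^K` (finite sum over multi-indices `K`). -/
abbrev DiffOp (n : ℕ) (ι : Type) : Type := (Fin n → ℕ) →₀ JetFn n ι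

def DiffOp.IsDifferential (P : DiffOp n ι) : Prop := ∀ K, Jets.IsDifferential (P K)

/-- `∑_K λ^K D^K f`. -/
def DiffOp.app (P : DiffOp n ι) (f : JetFn n ι) : JetFn n ι :=
  fun z => P.sum fun K a => a z * DD K f z

/-! ### The system, its formal Lagrangian and its adjoint -/

/-- Forget the variables with index in `κ`. -/
def proj (z : Jet n (ι ⊕ κ)) : Jet n ι := Sum.elim (fun i => z (Sum.inl i))
  (fun p => z (Sum.inr (Sum.inl p.1, p.2)))

/-- A function of `x`, `u` and derivatives of `u`, seen as a function on the larger jet space. -/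
def lift (f : JetFn n ι) : JetFn n (ι ⊕ κ) := fun z => f (proj z)

/-- Indices of the dependent variables `(u, ũ)`. -/
abbrev Vars (m mt : ℕ) : Type := Fin m ⊕ Fin mt

/-- Indices of the dependent variables `(u, ũ, v, ṽ)`. -/
abbrev Vars2 (m mt : ℕ) : Type := Vars m mt ⊕ Vars m mt

variable {m mt : ℕ}

/-- `v^β`. -/
def v (β : Fin m) : JetFn n (Vars2 m mt) := dep (Sum.inr (Sum.inl β)) 0

/-- `ṽ^β`. -/
def vt (β : Fin mt) : JetFn n (Vars2 m mt) := dep (Sum.inr (Sum.inr β)) 0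

/-- `w^β = v^β + ∑ ṽ^γ`. -/
def w (β : Fin m) : JetFn n (Vars2 m mt) := fun z => v β z + ∑ γ : Fin mt, vt γ z

/-- The formal Lagrangian `L = ∑ v^β F_β + (∑ ṽ^γ) (∑ F_ν)`. -/
def formalL (F : Fin m → JetFn n (Vars m mt)) : JetFn n (Vars2 m mt) := fun z =>
  (∑ β, v β z * lift (F β) z) + (∑ γ : Fin mt, vt γ z) * ∑ ν, lift (F ν) z

/-- `F*_α = δL/δu^α`. -/
def adj (F : Fin m → JetFn n (Vars m mt)) (α : Fin m) : JetFn n (Vars2 m mt) :=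
  euler (Sum.inl (Sum.inl α)) (formalL F)

/-- `F̃*_α = δL/δũ^α`. -/
def adjt (F : Fin m → JetFn n (Vars m mt)) (α : Fin mt) : JetFn n (Vars2 m mt) :=
  euler (Sum.inl (Sum.inr α)) (formalL F)

/-- `U = (u, ũ, v, ṽ)` is a (smooth) solution on `Ω` of the system `F = 0` together with its
adjoint equations `F* = 0`, `F̃* = 0`. -/
def IsSolution (F : Fin m → JetFn n (Vars m mt)) (Ω : Set (Fin n → ℝ))
    (U : (Fin n → ℝ) → Vars2 m mt → ℝ) : Prop :=
  ContDiffOn ℝ ∞ U Ω ∧ ∀ x ∈ Ω,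
    (∀ α, F α (proj (jet U x)) = 0) ∧ (∀ α, adj F α (jet U x) = 0) ∧ ∀ α, adjt F α (jet U x) = 0

/-- `C` is a conserved vector for the system `F = 0` together with its adjoint equations: it
consists of differential functions, and `div C = 0` on every solution. -/
def IsConservedVector (F : Fin m → JetFn n (Vars m mt)) (C : Fin n → JetFn n (Vars2 m mt)) :
    Prop :=
  (∀ i, IsDifferential (C i)) ∧ ∀ (Ω : Set (Fin n → ℝ)) (U : (Fin n → ℝ) → Vars2 m mt → ℝ),
    IsOpen Ω → IsSolution F Ω U → ∀ x ∈ Ω, tdiv C (jet U x) = 0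

/-! ### Symmetries of the system and their extensions -/

/-- `X` generates a group of point symmetries of `F = 0`, with multipliers `λ_{αβ}`:
`Pr X (F_α) = ∑_β λ_{αβ} F_β`. -/
def IsPointSymmetry (F : Fin m → JetFn n (Vars m mt)) (X : GenOp n (Vars m mt))
    (lam : Fin m → Fin m → JetFn n (Vars m mt)) : Prop :=
  X.IsDifferential ∧ X.IsPoint ∧ (∀ α β, IsDifferential (lam α β)) ∧
    ∀ α z, X.pr (F α) z = ∑ β, lam α β z * F β z

/-- `X` is a Lie-Bäcklund operator admitted by `F = 0`: `Pr X (F_ν) = ∑_μ P_{νμ} (F_μ)` with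
differential operators `P_{νμ}`. -/
def IsLieBacklundSymmetry (F : Fin m → JetFn n (Vars m mt)) (X : GenOp n (Vars m mt))
    (P : Fin m → Fin m → DiffOp n (Vars m mt)) : Prop :=
  X.IsDifferential ∧ (∀ ν μ, (P ν μ).IsDifferential) ∧
    ∀ ν z, X.pr (F ν) z = ∑ μ, (P ν μ).app (F μ) z

/-- `Y = X + ∑ η*_β ∂/∂v^β + ∑ η̃*_γ ∂/∂ṽ^γ`. -/
def extend (X : GenOp n (Vars m mt)) (es : Fin m → JetFn n (Vars2 m mt))
    (est : Fin mt → JetFn n (Vars2 m mt)) : GenOp n (Vars2 m mt) where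
  xi i := lift (X.xi i)
  eta := Sum.elim (fun j => lift (X.eta j)) (Sum.elim es est)

/-- The condition on `η*`, `η̃*` for a point symmetry: `η*_β + ∑ η̃*_γ = -[∑_α v^α λ_{αβ}
  + v^β div ξ + (∑ ṽ^γ) ∑_α λ_{αβ} + (∑ ṽ^γ) div ξ]`. -/
def IsPointExtension (X : GenOp n (Vars m mt)) (lam : Fin m → Fin m → JetFn n (Vars m mt))
    (es : Fin m → JetFn n (Vars2 m mt)) (est : Fin mt → JetFn n (Vars2 m mt)) : Prop :=
  (∀ β, IsDifferential (es β)) ∧ (∀ γ, IsDifferential (est γ)) ∧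
  ∀ β z, es β z + ∑ γ, est γ z =
    -((∑ α, v α z * lift (lam α β) z) + v β z * lift (tdiv X.xi) z
      + (∑ γ : Fin mt, vt γ z) * ∑ α, lift (lam α β) z
      + (∑ γ : Fin mt, vt γ z) * lift (tdiv X.xi) z)

/-- The condition on `η*`, `η̃*` for a Lie-Bäcklund symmetry: `η*_β + ∑ η̃*_γ =
  -[w^β div ξ + ∑_μ ∑_K (-1)^{|K|} D^K (w^μ λ^K_{μβ})]`. -/
def IsLieBacklundExtension (X : GenOp n (Vars m mt))
    (P : Fin m → Fin m → DiffOp n (Vars m mt))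
    (es : Fin m → JetFn n (Vars2 m mt)) (est : Fin mt → JetFn n (Vars2 m mt)) : Prop :=
  (∀ β, IsDifferential (es β)) ∧ (∀ γ, IsDifferential (est γ)) ∧
  ∀ β z, es β z + ∑ γ, est γ z =
    -(w β z * lift (tdiv X.xi) z
      + ∑ μ, (P μ β).sum fun K a => (-1) ^ ord K * DD K (fun z => w μ z * lift a z) z)

end Jets

end

open Jets

/-! Everything rests on an identity that holds at every point of the jet space, not only on
solutions. If `Pr V(L) + L div ξ = div B`, then Noether's vector satisfies `div C = -∑ W^j δL/δu^j`
(`tdiv_noether`). For the formal Lagrangian each term on the right dies on solutions. The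
variational derivatives in `u`, `ũ` are the adjoint equations. Those in `v`, `ṽ` are combinations of
the `F_β`, because `L = ∑ w^β F_β` with `w` linear in the undifferentiated `v`, `ṽ`
(`euler_inr_formalL`). Conservation thus needs only the invariance criterion for `Y`.

To obtain it, note that `Pr Y` is a derivation, so it sends `L` to `∑ (Y(w^β) F_β + w^β Pr X(F_β))`
with `Y(w^β) = η*_β + ∑ η̃*_γ` (`pr_extend_formalL`). The symmetry condition expresses `Pr X(F_β)`
through the `F_μ`. For point symmetries the prescribed sum `η*_β + ∑ η̃*_γ` cancels everything, and
`B = 0` works. For Lie-Bäcklund symmetries it contributes minus the formal adjoint of the operators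
applied to `w`, and what remains is a divergence by integration by parts.

One lemma, `tdiv_flux`, does both integrations by parts: with characteristics and `∂L/∂u_J` it gives
Noether's theorem, with `F_β` and `w^μ λ^K` it gives `B`. Its combinatorial core is
`sum_finsum_mc_sub`, a telescoping identity that follows from Pascal's rule for multinomial
coefficients. -/

noncomputable section

namespace Jets

variable {n : ℕ} {ι κ : Type}

/-! ### Closure properties of differential functions -/

/-- A smooth function of the coordinates in `S`. -/
def SmoothIn (S : Finset (Coord n ι)) (f : JetFn n ι) : Prop :=
  ∃ g : (S → ℝ) → ℝ, ContDiff ℝ ∞ g ∧ ∀ z, f z = g fun c => z c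

namespace SmoothIn

variable {S T : Finset (Coord n ι)} {f g : JetFn n ι}

theorem isDifferential (hf : SmoothIn S f) : IsDifferential f := ⟨S, hf⟩

theorem mono (hf : SmoothIn S f) (h : S ⊆ T) : SmoothIn T f := by
  obtain ⟨g, hg, hfg⟩ := hf
  refine ⟨fun y => g fun c => y ⟨c, h c.2⟩, hg.comp ?_, hfg⟩
  exact contDiff_pi.2 fun c => contDiff_apply ℝ ℝ _

theorem const (a : ℝ) : SmoothIn S (fun _ => a) := ⟨fun _ => a, contDiff_const, fun _ => rfl⟩

theorem coord {c : Coord n ι} (hc : c ∈ S) : SmoothIn S (fun z => z c) :=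
  ⟨fun y => y ⟨c, hc⟩, contDiff_apply ℝ ℝ _, fun _ => rfl⟩

theorem add (hf : SmoothIn S f) (hg : SmoothIn S g) : SmoothIn S (fun z => f z + g z) := by
  obtain ⟨f', hf', hf⟩ := hf
  obtain ⟨g', hg', hg⟩ := hg
  exact ⟨fun y => f' y + g' y, hf'.add hg', fun z => by simp only [hf, hg]⟩

theorem mul (hf : SmoothIn S f) (hg : SmoothIn S g) : SmoothIn S (fun z => f z * g z) := by
  obtain ⟨f', hf', hf⟩ := hf
  obtain ⟨g', hg', hg⟩ := hg
  exact ⟨fun y => f' y * g' y, hf'.mul hg', fun z => by simp only [hf, hg]⟩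

open Classical in
theorem hasDerivAt (hf : SmoothIn S f) (c : Coord n ι) (z : Jet n ι) :
    HasDerivAt (fun t => f (Function.update z c t)) (pd c f z) (z c) := by
  have : DifferentiableAt ℝ (fun t => f (Function.update z c t)) (z c) := by
    obtain ⟨g, hg, hfg⟩ := hf
    simp only [hfg]
    refine ((hg.differentiable (by simp)).differentiableAt).comp (z c)
      (differentiableAt_pi.2 fun d => ?_)
    by_cases h : (d : Coord n ι) = c
    · simp [h]
    · simp [h]
  exact this.hasDerivAt

open Classical in
theorem pd_eq_zero (hf : SmoothIn S f) {c : Coord n ι} (hc : c ∉ S) : pd c f = fun _ => 0 := by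
  obtain ⟨g, hg, hfg⟩ := hf
  funext z
  have : (fun t => f (Function.update z c t)) = fun _ => f z := by
    funext t
    rw [hfg, hfg]
    congr 1
    funext d
    exact Function.update_of_ne (fun h => hc (by rw [← h]; exact d.2)) _ _
  unfold pd
  rw [this]
  exact deriv_const (z c) (f z)

-- Transfers calculus on the finite-dimensional space `S → ℝ` to the jet space: moving one jet
-- coordinate moves the representing function along one basis vector.
open Classical in
theorem pd_eq_fderiv {g : (S → ℝ) → ℝ} (hg : Differentiable ℝ g) (hfg : ∀ z, f z = g fun c => z c)
    (c : S) (z : Jet n ι) : pd c f z = fderiv ℝ g (fun c => z c) (Pi.single c 1) := by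
  have hupd : ∀ t, (fun d : S => Function.update z (c : Coord n ι) t d)
      = Function.update (fun d : S => z d) c t := by
    intro t
    funext d
    by_cases h : d = c
    · subst h; simp
    · rw [Function.update_of_ne h, Function.update_of_ne (fun h' => h (Subtype.ext h'))]
  have h1 := hasDerivAt_update (fun d : S => z d) c (z c)
  have h2 : HasFDerivAt g (fderiv ℝ g fun c => z c)
      (Function.update (fun d : S => z d) c (z c)) := by
    have : Function.update (fun d : S => z d) c (z c) = fun d : S => z d :=
      Function.update_eq_self c _
    rw [this]
    exact (hg _).hasFDerivAt
  have h3 := (h2.comp_hasDerivAt (z c) h1).deriv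
  rw [← h3]
  unfold pd
  congr 1
  funext t
  rw [hfg, Function.comp_apply, ← hupd]

open Classical in
theorem pd (hf : SmoothIn S f) (c : Coord n ι) : SmoothIn S (pd c f) := by
  by_cases hc : c ∈ S
  · obtain ⟨g, hg, hfg⟩ := hf
    exact ⟨fun y => fderiv ℝ g y (Pi.single ⟨c, hc⟩ 1),
      (hg.fderiv_right (m := ∞) (by simp)).clm_apply contDiff_const,
      fun z => pd_eq_fderiv (hg.differentiable (by simp)) hfg ⟨c, hc⟩ z⟩
  · rw [hf.pd_eq_zero hc]
    exact const 0

-- Symmetry of the second derivative of the representing function; if one of the coordinates lies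
-- outside `S`, both sides vanish.
open Classical in
theorem pd_comm (hf : SmoothIn S f) (c d : Coord n ι) :
    Jets.pd c (Jets.pd d f) = Jets.pd d (Jets.pd c f) := by
  by_cases hc : c ∈ S
  · by_cases hd : d ∈ S
    · obtain ⟨g, hg, hfg⟩ := hf
      have hg1 : ContDiff ℝ ∞ (fderiv ℝ g) := hg.fderiv_right (m := ∞) (by simp)
      have key : ∀ (a b : S) (z : Jet n ι), Jets.pd (a : Coord n ι) (Jets.pd (b : Coord n ι) f) z
          = fderiv ℝ (fderiv ℝ g) (fun c => z c) (Pi.single a 1) (Pi.single b 1) := by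
        intro a b z
        rw [pd_eq_fderiv (g := fun y => fderiv ℝ g y (Pi.single b 1))
          ((hg1.clm_apply contDiff_const).differentiable (by simp))
          (fun z => pd_eq_fderiv (hg.differentiable (by simp)) hfg b z) a z,
          fderiv_clm_apply (hg1.differentiable (by simp) _) (differentiableAt_const _)]
        simp
      funext z
      rw [key ⟨c, hc⟩ ⟨d, hd⟩ z, key ⟨d, hd⟩ ⟨c, hc⟩ z]
      exact (hg.contDiffAt.isSymmSndFDerivAt
        (by simpa using WithTop.coe_le_coe.2 (le_top (a := (2 : ℕ∞))))) _ _
    · rw [hf.pd_eq_zero hd, (hf.pd c).pd_eq_zero hd, (const (S := ∅) 0).pd_eq_zero (by simp)]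
  · rw [hf.pd_eq_zero hc, (hf.pd d).pd_eq_zero hc, (const (S := ∅) 0).pd_eq_zero (by simp)]

end SmoothIn

theorem IsDifferential.exists_common {f g : JetFn n ι} (hf : IsDifferential f)
    (hg : IsDifferential g) : ∃ S, SmoothIn S f ∧ SmoothIn S g := by
  classical
  obtain ⟨S, hf⟩ := hf
  obtain ⟨T, hg⟩ := hg
  exact ⟨S ∪ T, SmoothIn.mono hf Finset.subset_union_left,
    SmoothIn.mono hg Finset.subset_union_right⟩

theorem isDifferential_const (a : ℝ) : IsDifferential (fun _ : Jet n ι => a) :=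
  (SmoothIn.const (S := ∅) a).isDifferential

theorem isDifferential_coord (c : Coord n ι) : IsDifferential (fun z : Jet n ι => z c) :=
  (SmoothIn.coord (Finset.mem_singleton_self c)).isDifferential

theorem isDifferential_dep (j : ι) (J : Fin n → ℕ) : IsDifferential (dep j J) :=
  isDifferential_coord _

namespace IsDifferential

variable {f g : JetFn n ι}

theorem add (hf : IsDifferential f) (hg : IsDifferential g) :
    IsDifferential (fun z => f z + g z) := by
  obtain ⟨S, hf, hg⟩ := hf.exists_common hg
  exact (hf.add hg).isDifferential

theorem mul (hf : IsDifferential f) (hg : IsDifferential g) :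
    IsDifferential (fun z => f z * g z) := by
  obtain ⟨S, hf, hg⟩ := hf.exists_common hg
  exact (hf.mul hg).isDifferential

theorem const_mul (a : ℝ) (hf : IsDifferential f) : IsDifferential (fun z => a * f z) :=
  (isDifferential_const a).mul hf

theorem neg (hf : IsDifferential f) : IsDifferential (fun z => -f z) := by
  simpa using hf.const_mul (-1)

theorem sub (hf : IsDifferential f) (hg : IsDifferential g) :
    IsDifferential (fun z => f z - g z) := by
  simpa [sub_eq_add_neg] using hf.add hg.neg

theorem sum {α : Type*} {f : α → JetFn n ι} (s : Finset α) (hf : ∀ a ∈ s, IsDifferential (f a)) :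
    IsDifferential (fun z => ∑ a ∈ s, f a z) := by
  classical
  induction s using Finset.induction_on with
  | empty => simpa using isDifferential_const 0
  | insert a s ha ih =>
    simp only [Finset.sum_insert ha]
    exact (hf a (Finset.mem_insert_self a s)).add
      (ih fun b hb => hf b (Finset.mem_insert_of_mem hb))

theorem pd (hf : IsDifferential f) (c : Coord n ι) : IsDifferential (pd c f) := by
  obtain ⟨S, hf⟩ := hf
  exact (SmoothIn.pd hf c).isDifferential

open Classical in
theorem hasDerivAt (hf : IsDifferential f) (c : Coord n ι) (z : Jet n ι) :
    HasDerivAt (fun t => f (Function.update z c t)) (Jets.pd c f z) (z c) := by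
  obtain ⟨S, hf⟩ := hf
  exact SmoothIn.hasDerivAt hf c z

theorem finite_pd (hf : IsDifferential f) : {c | Jets.pd c f ≠ fun _ => 0}.Finite := by
  obtain ⟨S, hf⟩ := hf
  exact S.finite_toSet.subset fun c hc => by
    by_contra h
    exact hc (SmoothIn.pd_eq_zero hf h)

theorem pd_add (hf : IsDifferential f) (hg : IsDifferential g) (c : Coord n ι) (z : Jet n ι) :
    Jets.pd c (fun z => f z + g z) z = Jets.pd c f z + Jets.pd c g z :=
  ((hf.add hg).hasDerivAt c z).unique ((hf.hasDerivAt c z).add (hg.hasDerivAt c z))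

theorem pd_mul (hf : IsDifferential f) (hg : IsDifferential g) (c : Coord n ι) (z : Jet n ι) :
    Jets.pd c (fun z => f z * g z) z = Jets.pd c f z * g z + f z * Jets.pd c g z := by
  have h := (hf.hasDerivAt c z).mul (hg.hasDerivAt c z)
  simp only [Function.update_eq_self] at h
  exact ((hf.mul hg).hasDerivAt c z).unique h

end IsDifferential

theorem pd_const (c : Coord n ι) (a : ℝ) : pd c (fun _ => a) = fun _ => 0 :=
  (SmoothIn.const (S := ∅) a).pd_eq_zero (by simp)

theorem pd_coord_self (c : Coord n ι) (z : Jet n ι) : pd c (fun z => z c) z = 1 := by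
  simp [pd]

theorem pd_coord_of_ne {c d : Coord n ι} (h : c ≠ d) (z : Jet n ι) :
    pd c (fun z => z d) z = 0 := by
  rw [(SmoothIn.coord (Finset.mem_singleton_self d)).pd_eq_zero (by simpa using h)]

/-! ### Derivations -/

/-- The derivation `∑ a_c ∂/∂c` at a point of the jet space. -/
def der (a : Coord n ι → ℝ) (f : JetFn n ι) (z : Jet n ι) : ℝ := ∑ᶠ c, a c * pd c f z

theorem SmoothIn.der_eq {S : Finset (Coord n ι)} {f : JetFn n ι} (hf : SmoothIn S f)
    (a : Coord n ι → ℝ) (z : Jet n ι) : der a f z = ∑ c ∈ S, a c * Jets.pd c f z := by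
  refine finsum_eq_sum_of_support_subset _ fun c hc => ?_
  by_contra h
  exact hc (by simp [hf.pd_eq_zero h])

theorem der_add {f g : JetFn n ι} (hf : IsDifferential f) (hg : IsDifferential g)
    (a : Coord n ι → ℝ) (z : Jet n ι) :
    der a (fun z => f z + g z) z = der a f z + der a g z := by
  obtain ⟨S, hS, hS'⟩ := hf.exists_common hg
  rw [(hS.add hS').der_eq, hS.der_eq, hS'.der_eq, ← Finset.sum_add_distrib]
  refine Finset.sum_congr rfl fun c _ => ?_
  rw [hf.pd_add hg]
  ring

/-- Total derivatives and prolongations are both of the form `der a`, so the Leibniz rule is needed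
only here. -/
theorem der_mul {f g : JetFn n ι} (hf : IsDifferential f) (hg : IsDifferential g)
    (a : Coord n ι → ℝ) (z : Jet n ι) :
    der a (fun z => f z * g z) z = der a f z * g z + f z * der a g z := by
  obtain ⟨S, hS, hS'⟩ := hf.exists_common hg
  rw [(hS.mul hS').der_eq, hS.der_eq, hS'.der_eq, Finset.sum_mul, Finset.mul_sum,
    ← Finset.sum_add_distrib]
  refine Finset.sum_congr rfl fun c _ => ?_
  rw [hf.pd_mul hg]
  ring

theorem der_const (b : ℝ) (a : Coord n ι → ℝ) (z : Jet n ι) : der a (fun _ => b) z = 0 := by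
  simp [der, pd_const]

theorem der_coord (c : Coord n ι) (a : Coord n ι → ℝ) (z : Jet n ι) :
    der a (fun z => z c) z = a c := by
  rw [(SmoothIn.coord (Finset.mem_singleton_self c)).der_eq, Finset.sum_singleton, pd_coord_self,
    mul_one]

theorem der_sum {α : Type*} {f : α → JetFn n ι} (s : Finset α)
    (hf : ∀ b ∈ s, IsDifferential (f b)) (a : Coord n ι → ℝ) (z : Jet n ι) :
    der a (fun z => ∑ b ∈ s, f b z) z = ∑ b ∈ s, der a (f b) z := by
  classical
  induction s using Finset.induction_on with
  | empty => simpa using der_const 0 a z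
  | insert b s hb ih =>
    simp only [Finset.sum_insert hb]
    rw [der_add (hf b (Finset.mem_insert_self b s))
      (IsDifferential.sum s fun c hc => hf c (Finset.mem_insert_of_mem hc)),
      ih fun c hc => hf c (Finset.mem_insert_of_mem hc)]

theorem finsum_sum_type {α β M : Type*} [AddCommMonoid M] (f : α ⊕ β → M)
    (hf : (Function.support f).Finite) :
    ∑ᶠ c, f c = ∑ᶠ a, f (Sum.inl a) + ∑ᶠ b, f (Sum.inr b) := by
  rw [← finsum_mem_univ, ← Set.range_inl_union_range_inr,
    finsum_mem_union' Set.isCompl_range_inl_range_inr.disjoint (hf.inter_of_right _)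
      (hf.inter_of_right _),
    finsum_mem_range Sum.inl_injective, finsum_mem_range Sum.inr_injective]

theorem IsDifferential.finite_support {f : JetFn n ι} (hf : IsDifferential f)
    (a : Coord n ι → ℝ) (z : Jet n ι) :
    (Function.support fun c => a c * Jets.pd c f z).Finite :=
  hf.finite_pd.subset fun c hc h => hc (by simp [h])

theorem IsDifferential.finite_support_inr {f : JetFn n ι} (hf : IsDifferential f)
    (a : ι × (Fin n → ℕ) → ℝ) (z : Jet n ι) :
    (Function.support fun p => a p * Jets.pd (Sum.inr p) f z).Finite :=
  (hf.finite_pd.preimage Sum.inr_injective.injOn).subset fun c hc h => hc (by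
    simp [show Jets.pd (Sum.inr c) f = _ from h])

theorem der_eq_split {f : JetFn n ι} (hf : IsDifferential f) (a : Coord n ι → ℝ) (z : Jet n ι) :
    der a f z = (∑ i, a (Sum.inl i) * pd (Sum.inl i) f z)
      + ∑ᶠ p, a (Sum.inr p) * pd (Sum.inr p) f z := by
  rw [der, finsum_sum_type _ (hf.finite_support a z), finsum_eq_sum_of_fintype]

/-! ### Total derivatives -/

/-- The coefficients of the total derivative `D_{x^i}`. -/
def shift (i : Fin n) : Coord n ι → JetFn n ι :=
  Sum.elim (fun k _ => if k = i then 1 else 0)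
    (fun p z => z (Sum.inr (p.1, p.2 + Pi.single i 1)))

theorem isDifferential_shift (i : Fin n) (c : Coord n ι) : IsDifferential (shift i c) := by
  rcases c with k | p
  · exact isDifferential_const _
  · exact isDifferential_coord _

theorem D_eq_der {f : JetFn n ι} (hf : IsDifferential f) (i : Fin n) (z : Jet n ι) :
    D i f z = der (fun c => shift i c z) f z := by
  simp [der_eq_split hf, D, shift]

theorem SmoothIn.D_eq {S : Finset (Coord n ι)} {f : JetFn n ι} (hf : SmoothIn S f) (i : Fin n) :
    D i f = fun z => ∑ c ∈ S, shift i c z * Jets.pd c f z := by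
  funext z
  rw [D_eq_der hf.isDifferential, hf.der_eq]

theorem IsDifferential.D {f : JetFn n ι} (hf : IsDifferential f) (i : Fin n) :
    IsDifferential (D i f) := by
  obtain ⟨S, hS⟩ := id hf
  rw [SmoothIn.D_eq hS]
  exact IsDifferential.sum S fun c _ => (isDifferential_shift i c).mul (hf.pd c)

theorem D_const (i : Fin n) (a : ℝ) : D i (fun _ : Jet n ι => a) = fun _ => 0 := by
  funext z
  rw [D_eq_der (isDifferential_const a), der_const]

theorem D_add {f g : JetFn n ι} (hf : IsDifferential f) (hg : IsDifferential g) (i : Fin n)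
    (z : Jet n ι) : D i (fun z => f z + g z) z = D i f z + D i g z := by
  rw [D_eq_der (hf.add hg), D_eq_der hf, D_eq_der hg, der_add hf hg]

theorem D_mul {f g : JetFn n ι} (hf : IsDifferential f) (hg : IsDifferential g) (i : Fin n)
    (z : Jet n ι) : D i (fun z => f z * g z) z = D i f z * g z + f z * D i g z := by
  rw [D_eq_der (hf.mul hg), D_eq_der hf, D_eq_der hg, der_mul hf hg]

theorem D_const_mul (a : ℝ) {f : JetFn n ι} (hf : IsDifferential f) (i : Fin n)
    (z : Jet n ι) : D i (fun z => a * f z) z = a * D i f z := by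
  rw [D_mul (isDifferential_const a) hf, D_const, zero_mul, zero_add]

theorem D_neg {f : JetFn n ι} (hf : IsDifferential f) (i : Fin n) (z : Jet n ι) :
    D i (fun z => -f z) z = -D i f z := by
  simpa using D_const_mul (-1) hf i z

theorem D_sum {α : Type*} {f : α → JetFn n ι} (s : Finset α)
    (hf : ∀ a ∈ s, IsDifferential (f a)) (i : Fin n) (z : Jet n ι) :
    D i (fun z => ∑ a ∈ s, f a z) z = ∑ a ∈ s, D i (f a) z := by
  rw [D_eq_der (IsDifferential.sum s hf), der_sum s hf]
  exact Finset.sum_congr rfl fun a ha => (D_eq_der (hf a ha) i z).symm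

theorem D_shift (i j : Fin n) (c : Coord n ι) (z : Jet n ι) :
    D i (shift j c) z = D j (shift i c) z := by
  rcases c with k | p
  · simp only [shift, Sum.elim_inl, D_const]
  · rw [D_eq_der (isDifferential_shift j _), D_eq_der (isDifferential_shift i _)]
    simp only [shift, Sum.elim_inr, der_coord]
    rw [add_right_comm]

/-- The second-order terms are symmetric by `pd_comm`. The first-order terms agree because
differentiating the coefficients, `D i (shift j c)`, is symmetric in `i` and `j` by `D_shift`. -/
theorem D_comm {f : JetFn n ι} (hf : IsDifferential f) (i j : Fin n) :
    D i (D j f) = D j (D i f) := by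
  obtain ⟨S, hS⟩ := id hf
  replace hS : SmoothIn S f := hS
  have key : ∀ (i j : Fin n) (z : Jet n ι), D i (D j f) z
      = (∑ c ∈ S, D i (shift j c) z * pd c f z)
        + ∑ c ∈ S, ∑ d ∈ S, shift j c z * (shift i d z * pd d (pd c f) z) := by
    intro i j z
    rw [hS.D_eq j, D_sum S fun c _ => (isDifferential_shift j c).mul (hf.pd c),
      ← Finset.sum_add_distrib]
    refine Finset.sum_congr rfl fun c _ => ?_
    rw [D_mul (isDifferential_shift j c) (hf.pd c), (hS.pd c).D_eq i, Finset.mul_sum]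
  funext z
  rw [key i j z, key j i z, Finset.sum_comm (s := S) (t := S)]
  congr 1
  · exact Finset.sum_congr rfl fun c _ => by rw [D_shift]
  · refine Finset.sum_congr rfl fun c _ => Finset.sum_congr rfl fun d _ => ?_
    rw [hS.pd_comm c d]
    ring

/-! ### Iterated total derivatives -/

theorem multi_mem {A : Type} {p : A → Prop} {T : Fin n → A → A} (hT : ∀ i a, p a → p (T i a))
    (J : Fin n → ℕ) {a : A} (ha : p a) : p (multi T J a) := by
  unfold multi
  induction List.finRange n with
  | nil => exact ha
  | cons i l ih => exact Function.Iterate.rec p ih (hT i) (J i)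

theorem iterate_comm_of_mem {A : Type} {p : A → Prop} {S T : A → A} (hS : ∀ a, p a → p (S a))
    (hc : ∀ a, p a → T (S a) = S (T a)) (k : ℕ) {a : A} (ha : p a) :
    T (S^[k] a) = S^[k] (T a) := by
  induction k generalizing a with
  | zero => rfl
  | succ k ih => rw [Function.iterate_succ_apply, Function.iterate_succ_apply, ih (hS a ha), hc a ha]

/-- Total derivatives are only known to commute on differential functions, hence the invariant
predicate `p`. The extra `T i` is moved outwards past the factors that precede `i` in the list. -/
theorem multi_add_single {A : Type} {p : A → Prop} {T : Fin n → A → A}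
    (hT : ∀ i a, p a → p (T i a)) (hc : ∀ i j a, p a → T i (T j a) = T j (T i a))
    (J : Fin n → ℕ) (i : Fin n) {a : A} (ha : p a) :
    multi T (J + Pi.single i 1) a = T i (multi T J a) := by
  have hp : ∀ (l : List (Fin n)) (J : Fin n → ℕ),
      p (l.foldr (fun i b => (T i)^[J i] b) a) := by
    intro l J
    induction l with
    | nil => exact ha
    | cons i l ih => exact Function.Iterate.rec p ih (hT i) (J i)
  -- The induction runs over sublists that may not contain `i` yet; without duplicates, `i`
  -- contributes at most once.
  have key : ∀ l : List (Fin n), l.Nodup →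
      l.foldr (fun k b => (T k)^[(J + Pi.single i 1 : Fin n → ℕ) k] b) a
        = if i ∈ l then T i (l.foldr (fun k b => (T k)^[J k] b) a)
          else l.foldr (fun k b => (T k)^[J k] b) a := by
    intro l hl
    induction l with
    | nil => simp
    | cons k l ih =>
      rw [List.nodup_cons] at hl
      rw [List.foldr_cons, List.foldr_cons, ih hl.2]
      by_cases hk : k = i
      · subst hk
        simp only [hl.1, if_false, List.mem_cons, true_or, if_true, Pi.add_apply, Pi.single_eq_same]
        rw [Function.iterate_succ_apply']
      · have hk' : i ≠ k := fun h => hk h.symm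
        simp only [List.mem_cons, hk', false_or, Pi.add_apply, Pi.single_eq_of_ne hk, add_zero]
        split_ifs
        · rw [iterate_comm_of_mem (hT k) (fun a ha => hc i k a ha) _ (hp l J)]
        · rfl
  have h := key _ (List.nodup_finRange n)
  rw [if_pos (List.mem_finRange i)] at h
  exact h

theorem DD_zero (f : JetFn n ι) : DD 0 f = f := by
  unfold DD multi
  induction List.finRange n with
  | nil => rfl
  | cons i l ih => rw [List.foldr_cons, ih]; rfl

theorem IsDifferential.DD {f : JetFn n ι} (hf : IsDifferential f) (J : Fin n → ℕ) :
    IsDifferential (DD J f) :=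
  multi_mem (p := IsDifferential) (fun i _ ha => IsDifferential.D ha i) J hf

theorem DD_add_single {f : JetFn n ι} (hf : IsDifferential f) (J : Fin n → ℕ) (i : Fin n) :
    DD (J + Pi.single i 1) f = D i (DD J f) :=
  multi_add_single (fun i _ ha => IsDifferential.D ha i) (fun i j _ ha => D_comm ha i j) J i hf

theorem DD_zero_fun (J : Fin n → ℕ) : DD J (fun _ : Jet n ι => 0) = fun _ => 0 :=
  multi_mem (p := fun f : JetFn n ι => f = fun _ => 0)
    (fun i _ ha => by rw [ha, D_const]) J rfl

/-! ### Summation by parts for multinomial weights -/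

open Classical in
theorem finsum_comp_of_injective {α β M : Type*} [AddCommMonoid M] {e : α → β}
    (he : Function.Injective e) {f : β → M} (hf : ∀ b ∉ Set.range e, f b = 0) :
    ∑ᶠ a, f (e a) = ∑ᶠ b, f b := by
  rw [← finsum_mem_range he]
  refine finsum_congr fun b => ?_
  by_cases hb : b ∈ Set.range e
  · rw [finsum_eq_if, if_pos hb]
  · rw [finsum_eq_if, if_neg hb, hf b hb]

/-- The multinomial coefficient `|J|! / (J_1! ⋯ J_n!)`. -/
def mc (J : Fin n → ℕ) : ℝ := Nat.multinomial Finset.univ J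

theorem mc_pos (J : Fin n → ℕ) : 0 < mc J := Nat.cast_pos.2 (Nat.multinomial_pos _ _)

theorem mc_zero : mc (0 : Fin n → ℕ) = 1 := by simp [mc, Nat.multinomial]

theorem ord_add_single (J : Fin n → ℕ) (i : Fin n) : ord (J + Pi.single i 1) = ord J + 1 := by
  simp [ord, Finset.sum_add_distrib]

theorem mc_add_single (k : Fin n → ℕ) (i : Fin n) :
    ((k i : ℝ) + 1) * mc (k + Pi.single i 1) = (ord k + 1) * mc k := by
  have h1 := Nat.multinomial_spec Finset.univ k
  have h2 := Nat.multinomial_spec Finset.univ (k + Pi.single i 1)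
  have h3 : ∏ j, ((k + Pi.single i 1 : Fin n → ℕ) j).factorial
      = (k i + 1) * ∏ j, (k j).factorial := by
    rw [← Finset.mul_prod_erase _ _ (Finset.mem_univ i),
      ← Finset.mul_prod_erase _ (fun j => (k j).factorial) (Finset.mem_univ i), ← mul_assoc]
    congr 1
    · simp [Nat.factorial_succ]
    · refine Finset.prod_congr rfl fun j hj => ?_
      simp [Pi.single_eq_of_ne (Finset.ne_of_mem_erase hj)]
  have h4 : ∑ j, (k + Pi.single i 1 : Fin n → ℕ) j = ∑ j, k j + 1 := ord_add_single k i
  rw [h3, h4, Nat.factorial_succ, ← h1] at h2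
  have h5 : 0 < ∏ j, (k j).factorial := Finset.prod_pos fun j _ => Nat.factorial_pos _
  have h6 : (k i + 1) * Nat.multinomial Finset.univ (k + Pi.single i 1)
      = (∑ j, k j + 1) * Nat.multinomial Finset.univ k := by
    refine Nat.eq_of_mul_eq_mul_left h5 ?_
    linarith
  unfold mc ord
  exact_mod_cast h6

/-- The multinomial coefficient of `J - e_i`, or `0` if `J_i = 0`. -/
def mcPred (i : Fin n) (J : Fin n → ℕ) : ℝ := if J i = 0 then 0 else mc (J - Pi.single i 1)

theorem mcPred_add_single (i : Fin n) (k : Fin n → ℕ) : mcPred i (k + Pi.single i 1) = mc k := by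
  simp [mcPred]

theorem mem_range_add_single {i : Fin n} {J : Fin n → ℕ} (h : J i ≠ 0) :
    J ∈ Set.range fun k : Fin n → ℕ => k + Pi.single i 1 := by
  refine ⟨J - Pi.single i 1, ?_⟩
  funext j
  by_cases hj : j = i
  · subst hj
    simp
    omega
  · simp [hj]

theorem ord_mul_mcPred (i : Fin n) (J : Fin n → ℕ) : ord J * mcPred i J = J i * mc J := by
  by_cases h : J i = 0
  · simp [mcPred, h]
  · obtain ⟨k, rfl⟩ := mem_range_add_single h
    simp only
    rw [mcPred_add_single, ord_add_single]
    have := mc_add_single k i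
    simp only [Pi.add_apply, Pi.single_eq_same]
    push_cast
    linarith

/-- Pascal's rule: multiplied by `|J|`, the left side becomes `∑ J_i mc J = |J| mc J`. It fails only
at `J = 0`, which has no predecessor, and that defect produces the boundary terms in
`sum_finsum_mc_sub`. -/
theorem sum_mcPred (J : Fin n → ℕ) : ∑ i, mcPred i J = mc J - if J = 0 then 1 else 0 := by
  by_cases h : J = 0
  · subst h
    simp [mcPred, mc_zero]
  · have hord : (ord J : ℝ) ≠ 0 := by
      intro h0
      refine h (funext fun i => ?_)
      have h1 : ∑ i, J i = 0 := by exact_mod_cast h0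
      exact (Finset.sum_eq_zero_iff.1 h1) i (Finset.mem_univ i)
    rw [if_neg h, sub_zero]
    refine mul_left_cancel₀ hord ?_
    rw [Finset.mul_sum, Finset.sum_congr rfl fun i _ => ord_mul_mcPred i J, ← Finset.sum_mul]
    simp [ord]

/-- Reindexing by `k ↦ k + e_i`; the indices missed have `i`-th entry `0`, where `mcPred` is `0` by
convention. -/
theorem finsum_shift_fst (h : (Fin n → ℕ) × (Fin n → ℕ) → ℝ) (i : Fin n) :
    ∑ᶠ q : (Fin n → ℕ) × (Fin n → ℕ), mc q.1 * mc q.2 * h (q.1 + Pi.single i 1, q.2)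
      = ∑ᶠ q : (Fin n → ℕ) × (Fin n → ℕ), mcPred i q.1 * mc q.2 * h q := by
  rw [← finsum_comp_of_injective
    (e := fun q : (Fin n → ℕ) × (Fin n → ℕ) => (q.1 + Pi.single i 1, q.2))
    (f := fun q => mcPred i q.1 * mc q.2 * h q)]
  · simp only [mcPred_add_single]
  · rintro ⟨a, b⟩ ⟨c, d⟩ hq
    simpa using hq
  · rintro ⟨a, b⟩ hq
    have : a i = 0 := by
      by_contra ha
      obtain ⟨k, hk⟩ := mem_range_add_single ha
      exact hq ⟨(k, b), by simpa using hk⟩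
    simp [mcPred, this]

theorem finsum_swap {α β M : Type*} [AddCommMonoid M] (f : α × β → M) :
    ∑ᶠ q : β × α, f q.swap = ∑ᶠ q, f q :=
  finsum_comp_of_injective Prod.swap_injective fun b hb => absurd ⟨b.swap, by simp⟩ hb

theorem finsum_shift_snd (h : (Fin n → ℕ) × (Fin n → ℕ) → ℝ) (i : Fin n) :
    ∑ᶠ q : (Fin n → ℕ) × (Fin n → ℕ), mc q.1 * mc q.2 * h (q.1, q.2 + Pi.single i 1)
      = ∑ᶠ q : (Fin n → ℕ) × (Fin n → ℕ), mcPred i q.2 * mc q.1 * h q := by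
  rw [← finsum_swap, ← finsum_swap (fun q => mcPred i q.2 * mc q.1 * h q)]
  have := finsum_shift_fst (fun q => h q.swap) i
  simp only [Prod.fst_swap, Prod.snd_swap]
  rw [← this]
  refine finsum_congr fun q => ?_
  simp only [Prod.swap_prod_mk]
  ring

theorem finsum_ite_zero_snd (h : (Fin n → ℕ) × (Fin n → ℕ) → ℝ) :
    ∑ᶠ q : (Fin n → ℕ) × (Fin n → ℕ), (if q.2 = 0 then (1 : ℝ) else 0) * (mc q.1 * h q)
      = ∑ᶠ p, mc p * h (p, 0) := by
  rw [← finsum_comp_of_injective (e := fun p : Fin n → ℕ => (p, (0 : Fin n → ℕ)))]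
  · simp
  · intro a b hab
    simpa using hab
  · rintro ⟨a, b⟩ hq
    have : b ≠ 0 := fun hb => hq ⟨a, by simp [hb]⟩
    simp [this]

theorem finsum_ite_zero_fst (h : (Fin n → ℕ) × (Fin n → ℕ) → ℝ) :
    ∑ᶠ q : (Fin n → ℕ) × (Fin n → ℕ), (if q.1 = 0 then (1 : ℝ) else 0) * (mc q.2 * h q)
      = ∑ᶠ p, mc p * h (0, p) := by
  rw [← finsum_swap]
  exact finsum_ite_zero_snd fun q => h q.swap

theorem finite_support_mul_left {α : Type*} {h : α → ℝ} (hh : (Function.support h).Finite)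
    (a : α → ℝ) : (Function.support fun q => a q * h q).Finite :=
  hh.subset (Function.support_mul_subset_right a h)

/-- Summation by parts: the discrete identity behind Noether's vector. -/
theorem sum_finsum_mc_sub (h : (Fin n → ℕ) × (Fin n → ℕ) → ℝ) (hh : (Function.support h).Finite) :
    ∑ i, ∑ᶠ q : (Fin n → ℕ) × (Fin n → ℕ),
        mc q.1 * mc q.2 * (h (q.1 + Pi.single i 1, q.2) - h (q.1, q.2 + Pi.single i 1))
      = ∑ᶠ p, mc p * h (p, 0) - ∑ᶠ p, mc p * h (0, p) := by
  have hfin := fun a => finite_support_mul_left hh a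
  have h1 : ∀ i : Fin n, ∑ᶠ q : (Fin n → ℕ) × (Fin n → ℕ),
        mc q.1 * mc q.2 * (h (q.1 + Pi.single i 1, q.2) - h (q.1, q.2 + Pi.single i 1))
      = ∑ᶠ q : (Fin n → ℕ) × (Fin n → ℕ),
          (mcPred i q.1 * mc q.2 - mcPred i q.2 * mc q.1) * h q := by
    intro i
    have e1 : Function.Injective
        fun q : (Fin n → ℕ) × (Fin n → ℕ) => (q.1 + Pi.single i 1, q.2) := by
      rintro ⟨a, b⟩ ⟨c, d⟩ hq
      simpa using hq
    have e2 : Function.Injective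
        fun q : (Fin n → ℕ) × (Fin n → ℕ) => (q.1, q.2 + Pi.single i 1) := by
      rintro ⟨a, b⟩ ⟨c, d⟩ hq
      simpa using hq
    simp only [mul_sub, sub_mul]
    rw [finsum_sub_distrib (finite_support_mul_left (hh.preimage e1.injOn) _)
        (finite_support_mul_left (hh.preimage e2.injOn) _),
      finsum_sub_distrib (hfin _) (hfin _), finsum_shift_fst, finsum_shift_snd]
  rw [Finset.sum_congr rfl fun i _ => h1 i, ← finsum_sum_comm _ _ fun i _ => hfin _,
    ← finsum_ite_zero_snd, ← finsum_ite_zero_fst]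
  simp only [← mul_assoc]
  rw [← finsum_sub_distrib (hfin _) (hfin _)]
  refine finsum_congr fun q => ?_
  -- By Pascal's rule the total coefficient of `h (k, l)` is `(mc k - [k = 0]) mc l - (mc l - [l =
  -- 0]) mc k`; the products `mc k * mc l` cancel and only the boundary `k = 0` or `l = 0` survives.
  rw [← Finset.sum_mul, Finset.sum_sub_distrib, ← Finset.sum_mul, ← Finset.sum_mul, sum_mcPred,
    sum_mcPred]
  ring

/-! ### Integration by parts -/

/-- The part of Noether's vector that comes from one dependent variable: `W` is its
characteristic and `g J` stands for `∂L/∂u_J`. -/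
def flux (W : JetFn n ι) (g : (Fin n → ℕ) → JetFn n ι) (i : Fin n) : JetFn n ι := fun z =>
  ∑ᶠ q : (Fin n → ℕ) × (Fin n → ℕ), weight i q.1 q.2 * DD q.1 W z
    * ((-1) ^ ord q.2 * DD q.2 (g (q.1 + q.2 + Pi.single i 1)) z)

/-- A bound for `s` bounds both summands, and there are finitely many multi-indices below it. -/
theorem finite_add_mem {s : Set (Fin n → ℕ)} (hs : s.Finite) (c : Fin n → ℕ) :
    {q : (Fin n → ℕ) × (Fin n → ℕ) | q.1 + q.2 + c ∈ s}.Finite := by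
  obtain ⟨N, hN⟩ := hs.bddAbove
  refine ((Set.finite_Iic N).prod (Set.finite_Iic N)).subset fun q hq => ?_
  have h : ∀ j, q.1 j + q.2 j + c j ≤ N j := hN hq
  have h1 : ∀ j, q.1 j ≤ N j := fun j => by have := h j; omega
  have h2 : ∀ j, q.2 j ≤ N j := fun j => by have := h j; omega
  exact ⟨h1, h2⟩

section

variable {W : JetFn n ι} {g : (Fin n → ℕ) → JetFn n ι}

theorem finite_flux (hg : {J | g J ≠ fun _ => 0}.Finite) (c : Fin n → ℕ) :
    {q : (Fin n → ℕ) × (Fin n → ℕ) | DD q.2 (g (q.1 + q.2 + c)) ≠ fun _ => 0}.Finite :=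
  (finite_add_mem hg c).subset fun q hq h => hq (by rw [h, DD_zero_fun])

theorem flux_eq_sum (hg : {J | g J ≠ fun _ => 0}.Finite) (i : Fin n) :
    flux W g i = fun z => ∑ q ∈ (finite_flux hg (Pi.single i 1)).toFinset,
      weight i q.1 q.2 * DD q.1 W z
        * ((-1) ^ ord q.2 * DD q.2 (g (q.1 + q.2 + Pi.single i 1)) z) := by
  funext z
  refine finsum_eq_sum_of_support_subset _ fun q hq => ?_
  rw [Set.Finite.coe_toFinset]
  intro h
  exact hq (by simp [h])

theorem isDifferential_flux_term (hW : IsDifferential W) {G : JetFn n ι} (hG : IsDifferential G)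
    (a : ℝ) (k l : Fin n → ℕ) :
    IsDifferential fun z => a * DD k W z * ((-1) ^ ord l * DD l G z) :=
  ((hW.DD _).const_mul _).mul ((hG.DD _).const_mul _)

theorem IsDifferential.flux (hW : IsDifferential W) (hgd : ∀ J, IsDifferential (g J))
    (hg : {J | g J ≠ fun _ => 0}.Finite) (i : Fin n) : IsDifferential (flux W g i) := by
  rw [flux_eq_sum hg]
  exact IsDifferential.sum _ fun q _ => isDifferential_flux_term hW (hgd _) _ _ _

/-- Raising `l` by `e_i` flips the sign `(-1)^|l|`, so the two Leibniz terms enter as a difference,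
the shape summed by `sum_finsum_mc_sub`. -/
theorem D_flux (hW : IsDifferential W) (hgd : ∀ J, IsDifferential (g J))
    (hg : {J | g J ≠ fun _ => 0}.Finite) (i : Fin n) (z : Jet n ι) :
    D i (flux W g i) z = ∑ᶠ q : (Fin n → ℕ) × (Fin n → ℕ), weight i q.1 q.2
      * (DD (q.1 + Pi.single i 1) W z
          * ((-1) ^ ord q.2 * DD q.2 (g (q.1 + q.2 + Pi.single i 1)) z)
        - DD q.1 W z * ((-1) ^ ord (q.2 + Pi.single i 1)
          * DD (q.2 + Pi.single i 1) (g (q.1 + q.2 + Pi.single i 1)) z)) := by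
  rw [flux_eq_sum hg, D_sum _ fun q _ => isDifferential_flux_term hW (hgd _) _ _ _]
  symm
  rw [finsum_eq_sum_of_support_subset (s := (finite_flux hg (Pi.single i 1)).toFinset)]
  · refine Finset.sum_congr rfl fun q _ => ?_
    have hG := hgd (q.1 + q.2 + Pi.single i 1)
    rw [D_mul ((hW.DD _).const_mul _) ((hG.DD _).const_mul _), D_const_mul _ (hW.DD _),
      D_const_mul _ (hG.DD _), DD_add_single hW, DD_add_single hG, ord_add_single]
    ring
  · intro q hq
    rw [Set.Finite.coe_toFinset]
    intro h
    refine hq ?_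
    simp [DD_add_single (hgd _), h, D_const]

/-- Integration by parts:
`div (flux W g) = ∑_J D^J(W) g_J - W ∑_J (-1)^{|J|} D^J(g_J)`. -/
theorem tdiv_flux (hW : IsDifferential W) (hgd : ∀ J, IsDifferential (g J))
    (hg : {J | g J ≠ fun _ => 0}.Finite) (z : Jet n ι) :
    tdiv (flux W g) z = ∑ᶠ J, DD J W z * g J z - W z * ∑ᶠ J, (-1) ^ ord J * DD J (g J) z := by
  -- Both shifts of `(k, l)` have the total `k + l + e_i`, so dividing by `mc (k + l)` reproduces
  -- the denominator of `weight`. On the boundary this division cancels the factor `mc p`.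
  let h : (Fin n → ℕ) × (Fin n → ℕ) → ℝ := fun q =>
    DD q.1 W z * ((-1) ^ ord q.2 * DD q.2 (g (q.1 + q.2)) z) / mc (q.1 + q.2)
  have hh : (Function.support h).Finite := by
    have := finite_flux hg 0
    simp only [add_zero] at this
    exact this.subset fun q hq h0 => hq (by simp [h, h0])
  have key := sum_finsum_mc_sub h hh
  have e1 : ∀ p, mc p * h (p, 0) = DD p W z * g p z := by
    intro p
    have := (mc_pos p).ne'
    simp only [h, add_zero, DD_zero]
    field_simp
    simp [ord]
  have e2 : ∀ p, mc p * h (0, p) = W z * ((-1) ^ ord p * DD p (g p) z) := by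
    intro p
    have := (mc_pos p).ne'
    simp only [h, zero_add, DD_zero]
    field_simp
  simp only [e1, e2] at key
  rw [mul_finsum, ← key]
  refine Finset.sum_congr rfl fun i _ => ?_
  rw [D_flux hW hgd hg]
  refine finsum_congr fun q => ?_
  have e3 : q.1 + Pi.single i 1 + q.2 = q.1 + q.2 + Pi.single i 1 := add_right_comm _ _ _
  simp only [h, e3, ← add_assoc, weight, mc]
  ring

end

/-! ### Prolongations and Noether's theorem -/

namespace GenOp

variable {V : GenOp n ι}

/-- The coefficients of the prolongation of `V`. -/
def coeff (V : GenOp n ι) (z : Jet n ι) : Coord n ι → ℝ :=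
  Sum.elim (fun i => V.xi i z)
    (fun p => DD p.2 (V.W p.1) z + ∑ i, V.xi i z * dep p.1 (p.2 + Pi.single i 1) z)

theorem pr_eq_der {f : JetFn n ι} (hf : Jets.IsDifferential f) (V : GenOp n ι) (z : Jet n ι) :
    V.pr f z = der (V.coeff z) f z := by
  rw [der_eq_split hf]
  rfl

theorem IsDifferential.W (hV : V.IsDifferential) (j : ι) : Jets.IsDifferential (V.W j) :=
  (hV.2 j).sub (Jets.IsDifferential.sum _ fun i _ => (hV.1 i).mul (isDifferential_dep _ _))

/-- `Pr V (f) = ∑ ξ^i D_i f + ∑_{j,J} D^J(W^j) ∂f/∂u^j_J`. -/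
theorem pr_eq_sum_D_add [Fintype ι] {f : JetFn n ι} (hf : Jets.IsDifferential f) (z : Jet n ι) :
    V.pr f z = (∑ i, V.xi i z * D i f z)
      + ∑ j, ∑ᶠ J, DD J (V.W j) z * pd (Sum.inr (j, J)) f z := by
  have h1 : ∑ᶠ p : ι × (Fin n → ℕ), DD p.2 (V.W p.1) z * pd (Sum.inr p) f z
      = ∑ j, ∑ᶠ J, DD J (V.W j) z * pd (Sum.inr (j, J)) f z := by
    rw [finsum_curry _ (hf.finite_support_inr _ z), finsum_eq_sum_of_fintype]
  have h2 : ∑ᶠ p : ι × (Fin n → ℕ), ∑ i, V.xi i z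
        * (dep p.1 (p.2 + Pi.single i 1) z * pd (Sum.inr p) f z)
      = ∑ i, V.xi i z * ∑ᶠ p : ι × (Fin n → ℕ),
          dep p.1 (p.2 + Pi.single i 1) z * pd (Sum.inr p) f z := by
    rw [finsum_sum_comm _ _ fun i _ => finite_support_mul_left (hf.finite_support_inr _ z) _]
    exact Finset.sum_congr rfl fun i _ => (mul_finsum _ _).symm
  have h3 : ∀ p : ι × (Fin n → ℕ),
      (DD p.2 (V.W p.1) z + ∑ i, V.xi i z * dep p.1 (p.2 + Pi.single i 1) z) * pd (Sum.inr p) f z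
      = DD p.2 (V.W p.1) z * pd (Sum.inr p) f z + ∑ i, V.xi i z
        * (dep p.1 (p.2 + Pi.single i 1) z * pd (Sum.inr p) f z) := by
    intro p
    rw [add_mul, Finset.sum_mul]
    simp only [mul_assoc]
  unfold pr
  simp only [h3]
  rw [finsum_add_distrib (hf.finite_support_inr _ z), h1, h2]
  · simp only [D, mul_add, Finset.sum_add_distrib, dep]
    ring
  · simp only [← mul_assoc, ← Finset.sum_mul]
    exact hf.finite_support_inr _ z

end GenOp

theorem IsDifferential.finite_pd_inr {f : JetFn n ι} (hf : IsDifferential f) (j : ι) :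
    {J | Jets.pd (Sum.inr (j, J)) f ≠ fun _ => 0}.Finite :=
  hf.finite_pd.preimage fun a _ b _ h => by simpa using h

theorem isDifferential_flux_pd {L : JetFn n ι} {V : GenOp n ι} (hL : IsDifferential L)
    (hV : V.IsDifferential) (j : ι) (i : Fin n) : IsDifferential (flux (V.W j) (fun J => pd (Sum.inr (j, J)) L) i) :=
  (hV.W j).flux (fun _ => hL.pd _) (hL.finite_pd_inr j) i

theorem tdiv_sum {α : Type*} {C : α → Fin n → JetFn n ι} (s : Finset α)
    (hC : ∀ a ∈ s, ∀ i, IsDifferential (C a i)) (z : Jet n ι) :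
    tdiv (fun i z => ∑ a ∈ s, C a i z) z = ∑ a ∈ s, tdiv (C a) z := by
  unfold tdiv
  rw [Finset.sum_comm]
  exact Finset.sum_congr rfl fun i _ => D_sum s (fun a ha => hC a ha i) i z

section

variable [Fintype ι] {L : JetFn n ι} {V : GenOp n ι} {B : Fin n → JetFn n ι}

theorem noether_eq (i : Fin n) : noether L V B i = fun z =>
    -B i z + V.xi i z * L z + ∑ j, flux (V.W j) (fun J => pd (Sum.inr (j, J)) L) i z := rfl

theorem isDifferential_noether (hL : IsDifferential L) (hV : V.IsDifferential)
    (hB : ∀ i, IsDifferential (B i)) (i : Fin n) : IsDifferential (noether L V B i) := by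
  rw [noether_eq]
  exact ((hB i).neg.add ((hV.1 i).mul hL)).add
    (IsDifferential.sum _ fun j _ => isDifferential_flux_pd hL hV j i)

/-- Noether's theorem. -/
theorem tdiv_noether (hL : IsDifferential L) (hV : V.IsDifferential)
    (hB : ∀ i, IsDifferential (B i)) (hinv : IsDivInvariant L V B) (z : Jet n ι) :
    tdiv (noether L V B) z = -∑ j, V.W j z * euler j L z := by
  have hf := fun j => tdiv_flux (hV.W j) (fun J => hL.pd (Sum.inr (j, J))) (hL.finite_pd_inr j) z
  have h1 : tdiv (noether L V B) z = -tdiv B z + (L z * tdiv V.xi z + ∑ i, V.xi i z * D i L z)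
      + ∑ j, tdiv (flux (V.W j) (fun J => pd (Sum.inr (j, J)) L)) z := by
    rw [← tdiv_sum _ fun j _ i => isDifferential_flux_pd hL hV j i]
    unfold tdiv
    rw [← Finset.sum_neg_distrib, Finset.mul_sum, ← Finset.sum_add_distrib,
      ← Finset.sum_add_distrib, ← Finset.sum_add_distrib]
    refine Finset.sum_congr rfl fun i _ => ?_
    rw [noether_eq, D_add ((hB i).neg.add ((hV.1 i).mul hL))
        (IsDifferential.sum _ fun j _ => isDifferential_flux_pd hL hV j i),
      D_add (hB i).neg ((hV.1 i).mul hL), D_neg (hB i), D_mul (hV.1 i) hL]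
    ring
  -- `∑ ξ^i D_i L` and the sums `∑ D^J(W^j) ∂L/∂u^j_J` from the fluxes recombine to `Pr V(L)`, so
  -- invariance cancels all but the variational derivatives.
  rw [h1, ← hinv z, GenOp.pr_eq_sum_D_add hL, Finset.sum_congr rfl fun j _ => hf j,
    Finset.sum_sub_distrib]
  unfold euler
  ring

end

/-! ### Functions that do not depend on some of the variables -/

/-- The inclusion of the coordinates of the smaller jet space. -/
def coordInl : Coord n ι → Coord n (ι ⊕ κ) :=
  Sum.elim Sum.inl (fun p => Sum.inr (Sum.inl p.1, p.2))

theorem proj_apply (z : Jet n (ι ⊕ κ)) (c : Coord n ι) : proj z c = z (coordInl c) := by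
  rcases c with i | p <;> rfl

theorem coordInl_injective :
    Function.Injective (coordInl : Coord n ι → Coord n (ι ⊕ κ)) := by
  rintro (i | ⟨j, J⟩) (i' | ⟨j', J'⟩) h <;> simp_all [coordInl]

theorem IsDifferential.lift {f : JetFn n ι} (hf : IsDifferential f) :
    IsDifferential (lift f : JetFn n (ι ⊕ κ)) := by
  classical
  obtain ⟨S, g, hg, hfg⟩ := hf
  refine ⟨S.image coordInl, fun y => g fun c => y ⟨coordInl c, Finset.mem_image_of_mem _ c.2⟩,
    hg.comp (contDiff_pi.2 fun c => contDiff_apply ℝ ℝ _), fun z => ?_⟩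
  simp only [Jets.lift, hfg, proj_apply]

theorem proj_update_coordInl [DecidableEq (Coord n ι)] {_ : DecidableEq (Coord n (ι ⊕ κ))}
    (z : Jet n (ι ⊕ κ)) (c : Coord n ι) (t : ℝ) :
    proj (Function.update z (coordInl c) t) = Function.update (proj z) c t := by
  funext d
  rw [proj_apply]
  by_cases hd : d = c
  · subst hd
    simp
  · rw [Function.update_of_ne (fun h => hd (coordInl_injective h)), Function.update_of_ne hd,
      proj_apply]

theorem proj_update_inr {_ : DecidableEq (Coord n (ι ⊕ κ))} (z : Jet n (ι ⊕ κ)) (k : κ)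
    (J : Fin n → ℕ) (t : ℝ) :
    proj (Function.update z (Sum.inr (Sum.inr k, J)) t) = proj z := by
  funext d
  rw [proj_apply, proj_apply]
  exact Function.update_of_ne (by rcases d with i | p <;> simp [coordInl]) _ _

open Classical in
theorem pd_coordInl_lift (f : JetFn n ι) (c : Coord n ι) :
    pd (coordInl c) (lift f : JetFn n (ι ⊕ κ)) = lift (pd c f) := by
  funext z
  simp only [pd, lift, proj_update_coordInl, proj_apply]

theorem pd_inr_lift (f : JetFn n ι) (k : κ) (J : Fin n → ℕ) :
    pd (Sum.inr (Sum.inr k, J)) (lift f : JetFn n (ι ⊕ κ)) = fun _ => 0 := by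
  funext z
  simp only [pd, lift, proj_update_inr, deriv_const]

theorem finsum_pd_lift (f : JetFn n ι) (a : (ι ⊕ κ) × (Fin n → ℕ) → ℝ) (z : Jet n (ι ⊕ κ)) :
    ∑ᶠ p, a p * pd (Sum.inr p) (lift f) z
      = ∑ᶠ p : ι × (Fin n → ℕ), a (Sum.inl p.1, p.2) * pd (Sum.inr p) f (proj z) := by
  rw [← finsum_comp_of_injective
    (e := fun p : ι × (Fin n → ℕ) => ((Sum.inl p.1 : ι ⊕ κ), p.2))]
  · refine finsum_congr fun p => ?_
    rw [show (Sum.inr (Sum.inl p.1, p.2) : Coord n (ι ⊕ κ)) = coordInl (Sum.inr p) from rfl,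
      pd_coordInl_lift]
    rfl
  · rintro ⟨a, b⟩ ⟨c, d⟩ h
    simpa using h
  · rintro ⟨j | k, J⟩ h
    · exact absurd ⟨(j, J), rfl⟩ h
    · rw [pd_inr_lift, mul_zero]

theorem pd_inl_lift (f : JetFn n ι) (i : Fin n) :
    pd (Sum.inl i) (lift f : JetFn n (ι ⊕ κ)) = lift (pd (Sum.inl i) f) :=
  pd_coordInl_lift f (Sum.inl i)

theorem D_lift (i : Fin n) (f : JetFn n ι) :
    D i (lift f : JetFn n (ι ⊕ κ)) = lift (D i f) := by
  funext z
  simp only [D, finsum_pd_lift f (fun p => z (Sum.inr (p.1, p.2 + Pi.single i 1))), pd_inl_lift]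
  rfl

theorem multi_semiconj {A A' : Type} {T : Fin n → A → A} {T' : Fin n → A' → A'} {φ : A → A'}
    (h : ∀ i, Function.Semiconj φ (T i) (T' i)) (J : Fin n → ℕ) (a : A) :
    multi T' J (φ a) = φ (multi T J a) := by
  unfold multi
  induction List.finRange n with
  | nil => rfl
  | cons i l ih =>
    rw [List.foldr_cons, List.foldr_cons, ih]
    exact (((h i).iterate_right (J i)) _).symm

theorem DD_lift (J : Fin n → ℕ) (f : JetFn n ι) :
    DD J (lift f : JetFn n (ι ⊕ κ)) = lift (DD J f) :=
  multi_semiconj (fun i g => (D_lift i g).symm) J f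

theorem tdiv_lift (C : Fin n → JetFn n ι) :
    tdiv (fun i => (lift (C i) : JetFn n (ι ⊕ κ))) = lift (tdiv C) := by
  funext z
  simp only [tdiv, D_lift, lift]

/-- The action of `V` on the added variables is invisible to `lift f`, and on the old ones `W^j`
involves only old variables. -/
theorem GenOp.pr_lift {V : GenOp n (ι ⊕ κ)} {X : GenOp n ι} (hxi : ∀ i, V.xi i = lift (X.xi i))
    (heta : ∀ j, V.eta (Sum.inl j) = lift (X.eta j)) (f : JetFn n ι) :
    V.pr (lift f) = lift (X.pr f) := by
  have hW : ∀ j, V.W (Sum.inl j) = lift (X.W j) := by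
    intro j
    funext z
    simp only [GenOp.W, hxi, heta]
    rfl
  funext z
  unfold GenOp.pr
  refine congrArg₂ (· + ·) ?_ ((finsum_pd_lift f (fun p => DD p.2 (V.W p.1) z
    + ∑ i, V.xi i z * dep p.1 (p.2 + Pi.single i 1) z) z).trans ?_)
  · simp only [hxi, pd_inl_lift]
    rfl
  · simp only [hW, DD_lift, hxi]
    rfl

/-- At order zero the terms `ξ^i u^j_{x^i}` subtracted in `W^j` are added back by the prolongation.
-/
theorem GenOp.pr_dep_zero (V : GenOp n ι) (j : ι) (z : Jet n ι) :
    V.pr (dep j 0) z = V.eta j z := by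
  rw [GenOp.pr_eq_der (isDifferential_dep j 0)]
  unfold dep
  rw [der_coord]
  simp [GenOp.coeff, DD_zero, GenOp.W]

/-! ### Variational derivatives -/

theorem pd_sum {α : Type*} {f : α → JetFn n ι} (s : Finset α)
    (hf : ∀ b ∈ s, IsDifferential (f b)) (c : Coord n ι) (z : Jet n ι) :
    pd c (fun z => ∑ b ∈ s, f b z) z = ∑ b ∈ s, pd c (f b) z := by
  classical
  induction s using Finset.induction_on with
  | empty => simp [pd_const]
  | insert b s hb ih =>
    simp only [Finset.sum_insert hb]
    rw [IsDifferential.pd_add (hf b (Finset.mem_insert_self b s))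
      (IsDifferential.sum s fun c hc => hf c (Finset.mem_insert_of_mem hc)),
      ih fun c hc => hf c (Finset.mem_insert_of_mem hc)]

theorem euler_eq_pd {f : JetFn n ι} {j : ι}
    (h : ∀ J, J ≠ 0 → pd (Sum.inr (j, J)) f = fun _ => 0) (z : Jet n ι) :
    euler j f z = pd (Sum.inr (j, 0)) f z := by
  unfold euler
  rw [finsum_eq_single _ 0 fun J hJ => by rw [h J hJ, DD_zero_fun, mul_zero]]
  simp [DD_zero, ord]

/-! ### The formal Lagrangian -/

variable {m mt : ℕ}

theorem isDifferential_v (β : Fin m) : IsDifferential (v β : JetFn n (Vars2 m mt)) :=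
  isDifferential_dep _ _

theorem isDifferential_vt (γ : Fin mt) : IsDifferential (vt γ : JetFn n (Vars2 m mt)) :=
  isDifferential_dep _ _

theorem isDifferential_w (β : Fin m) : IsDifferential (w β : JetFn n (Vars2 m mt)) :=
  (isDifferential_v β).add (IsDifferential.sum _ fun γ _ => isDifferential_vt γ)

/-- `v` and `ṽ` enter only through `w`, which is why only the sums `η*_β + ∑ η̃*_γ` are ever
constrained. -/
theorem formalL_eq (F : Fin m → JetFn n (Vars m mt)) :
    formalL F = fun z => ∑ β, w β z * lift (F β) z := by
  funext z
  simp only [formalL, w, add_mul, Finset.sum_add_distrib, Finset.mul_sum]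

section

variable {F : Fin m → JetFn n (Vars m mt)}

theorem isDifferential_formalL (hF : ∀ α, IsDifferential (F α)) :
    IsDifferential (formalL F) := by
  rw [formalL_eq]
  exact IsDifferential.sum _ fun β _ => (isDifferential_w β).mul (hF β).lift

theorem pd_inr_formalL (hF : ∀ α, IsDifferential (F α)) (k : Vars m mt) (J : Fin n → ℕ)
    (z : Jet n (Vars2 m mt)) :
    pd (Sum.inr (Sum.inr k, J)) (formalL F) z
      = ∑ β, pd (Sum.inr (Sum.inr k, J)) (w β) z * lift (F β) z := by
  rw [formalL_eq, pd_sum _ fun β _ => (isDifferential_w β).mul (hF β).lift]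
  refine Finset.sum_congr rfl fun β _ => ?_
  rw [(isDifferential_w β).pd_mul (hF β).lift, pd_inr_lift, mul_zero, add_zero]

theorem pd_w_eq_zero (k : Vars2 m mt) {J : Fin n → ℕ} (hJ : J ≠ 0) (β : Fin m)
    (z : Jet n (Vars2 m mt)) : pd (Sum.inr (k, J)) (w β) z = 0 := by
  have h : ∀ j : Vars2 m mt, pd (Sum.inr (k, J)) (dep j 0) z = 0 := fun j =>
    pd_coord_of_ne (by simp [hJ]) z
  unfold w
  rw [(isDifferential_v β).pd_add (IsDifferential.sum _ fun γ _ => isDifferential_vt γ),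
    pd_sum _ fun γ _ => isDifferential_vt γ]
  simp [v, vt, h]

/-- `F` is free of `v`, `ṽ`, and `w` contains them undifferentiated, so only the term of order zero
survives. -/
theorem euler_inr_formalL (hF : ∀ α, IsDifferential (F α)) (k : Vars m mt)
    (z : Jet n (Vars2 m mt)) :
    euler (Sum.inr k) (formalL F) z
      = ∑ β, pd (Sum.inr (Sum.inr k, 0)) (w β) z * lift (F β) z := by
  rw [euler_eq_pd, pd_inr_formalL hF]
  intro J hJ
  funext z
  rw [pd_inr_formalL hF]
  refine Finset.sum_eq_zero fun β _ => ?_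
  rw [pd_w_eq_zero _ hJ, zero_mul]

/-- Noether's vector is conserved for the system together with its adjoint. -/
theorem isConservedVector_noether (hF : ∀ α, IsDifferential (F α)) {V : GenOp n (Vars2 m mt)}
    (hV : V.IsDifferential) {B : Fin n → JetFn n (Vars2 m mt)} (hB : ∀ i, IsDifferential (B i))
    (hinv : IsDivInvariant (formalL F) V B) :
    IsConservedVector F (noether (formalL F) V B) := by
  have hL := isDifferential_formalL hF
  refine ⟨isDifferential_noether hL hV hB, fun Ω U _ hU x hx => ?_⟩
  obtain ⟨h1, h2, h3⟩ := hU.2 x hx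
  rw [tdiv_noether hL hV hB hinv, neg_eq_zero]
  refine Finset.sum_eq_zero fun j _ => ?_
  -- For `u` and `ũ` the adjoint equations apply; for `v` and `ṽ` the system `F = 0` itself.
  rcases j with (α | γ) | k
  · exact mul_eq_zero_of_right _ (h2 α)
  · exact mul_eq_zero_of_right _ (h3 γ)
  · rw [euler_inr_formalL hF]
    simp [lift, h1]

/-! ### Extensions of symmetries -/

variable {X : GenOp n (Vars m mt)} {es : Fin m → JetFn n (Vars2 m mt)}
  {est : Fin mt → JetFn n (Vars2 m mt)}

theorem isDifferential_tdiv {C : Fin n → JetFn n ι} (hC : ∀ i, IsDifferential (C i)) :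
    IsDifferential (tdiv C) :=
  IsDifferential.sum _ fun i _ => (hC i).D i

theorem isDifferential_extend (hX : X.IsDifferential) (hes : ∀ β, IsDifferential (es β))
    (hest : ∀ γ, IsDifferential (est γ)) : (extend X es est).IsDifferential := by
  refine ⟨fun i => (hX.1 i).lift, ?_⟩
  rintro (j | β | γ)
  · exact (hX.2 j).lift
  · exact hes β
  · exact hest γ

theorem pr_extend_formalL (hF : ∀ α, IsDifferential (F α)) (z : Jet n (Vars2 m mt)) :
    (extend X es est).pr (formalL F) z
      = ∑ β, ((es β z + ∑ γ, est γ z) * lift (F β) z + w β z * lift (X.pr (F β)) z) := by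
  rw [GenOp.pr_eq_der (isDifferential_formalL hF), formalL_eq,
    der_sum _ fun β _ => (isDifferential_w β).mul (hF β).lift]
  refine Finset.sum_congr rfl fun β _ => ?_
  have hd : ∀ k : Vars2 m mt, der ((extend X es est).coeff z) (dep k 0) z
      = (extend X es est).eta k z := fun k => by
    rw [← GenOp.pr_eq_der (isDifferential_dep k 0), GenOp.pr_dep_zero]
  have hw : der ((extend X es est).coeff z) (w β) z = es β z + ∑ γ, est γ z := by
    unfold w
    rw [der_add (isDifferential_v β) (IsDifferential.sum _ fun γ _ => isDifferential_vt γ),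
      der_sum _ fun γ _ => isDifferential_vt γ]
    simp only [v, vt, hd]
    rfl
  rw [der_mul (isDifferential_w β) (hF β).lift, hw, ← GenOp.pr_eq_der (hF β).lift,
    GenOp.pr_lift (X := X) (fun _ => rfl) (fun _ => rfl)]

/-- Collects the terms so that the coefficient of `F_β` is what the extension conditions prescribe.
-/
theorem pr_extend_formalL_add (hF : ∀ α, IsDifferential (F α)) (z : Jet n (Vars2 m mt)) :
    (extend X es est).pr (formalL F) z + formalL F z * tdiv (extend X es est).xi z
      = ∑ β, ((es β z + ∑ γ, est γ z + w β z * lift (tdiv X.xi) z) * lift (F β) z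
        + w β z * lift (X.pr (F β)) z) := by
  rw [pr_extend_formalL hF, formalL_eq,
    show tdiv (extend X es est).xi z = lift (tdiv X.xi) z from congrFun (tdiv_lift X.xi) z,
    Finset.sum_mul, ← Finset.sum_add_distrib]
  refine Finset.sum_congr rfl fun β _ => ?_
  ring

/-- The part `w^β div ξ` splits among `v^β` and the `ṽ^γ`; the multiplier part goes entirely to
`η*_β`. -/
theorem isPointExtension_canonical {lam : Fin m → Fin m → JetFn n (Vars m mt)}
    (hX : X.IsDifferential) (hlam : ∀ α β, IsDifferential (lam α β)) :
    IsPointExtension X lam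
      (fun β z => -((∑ α, w α z * lift (lam α β) z) + v β z * lift (tdiv X.xi) z))
      (fun γ z => -(vt γ z * lift (tdiv X.xi) z)) := by
  have hdiv := (isDifferential_tdiv hX.1).lift (κ := Vars m mt)
  refine ⟨fun β => ?_, fun γ => ?_, fun β z => ?_⟩
  · exact ((IsDifferential.sum _ fun α _ => (isDifferential_w α).mul (hlam α β).lift).add
      ((isDifferential_v β).mul hdiv)).neg
  · exact ((isDifferential_vt γ).mul hdiv).neg
  · simp only [w, add_mul, Finset.sum_add_distrib, Finset.sum_neg_distrib, ← Finset.mul_sum,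
      ← Finset.sum_mul]
    ring

theorem isDivInvariant_of_isPointExtension (hF : ∀ α, IsDifferential (F α))
    {lam : Fin m → Fin m → JetFn n (Vars m mt)} (hX : IsPointSymmetry F X lam)
    (h : IsPointExtension X lam es est) :
    IsDivInvariant (formalL F) (extend X es est) (fun _ _ => 0) := by
  intro z
  have h0 : tdiv (fun _ _ => 0 : Fin n → JetFn n (Vars2 m mt)) z = 0 := by
    simp [tdiv, D_const]
  have h1 : ∀ β, es β z + ∑ γ, est γ z + w β z * lift (tdiv X.xi) z
      = -∑ α, w α z * lift (lam α β) z := by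
    intro β
    rw [h.2.2 β z]
    simp only [w, add_mul, Finset.sum_add_distrib, ← Finset.mul_sum]
    ring
  have h2 : ∀ β, lift (X.pr (F β)) z = ∑ α, lift (lam β α) z * lift (F α) z :=
    fun β => hX.2.2.2 β (proj z)
  rw [pr_extend_formalL_add hF, h0]
  simp only [h1, h2, Finset.sum_add_distrib, neg_mul, Finset.sum_neg_distrib, Finset.sum_mul,
    Finset.mul_sum]
  -- Both double sums consist of the terms `w^α λ_{αβ} F_β`, with the summations in opposite order.
  rw [Finset.sum_comm, neg_add_eq_zero]
  simp only [mul_assoc]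

/-- The coefficients `w^μ λ^K_{μβ}` of the adjoint of `P`. -/
def adjCoeff (P : Fin m → Fin m → DiffOp n (Vars m mt)) (μ β : Fin m) (K : Fin n → ℕ) :
    JetFn n (Vars2 m mt) := fun z => w μ z * lift (P μ β K) z

theorem finite_adjCoeff (P : Fin m → Fin m → DiffOp n (Vars m mt)) (μ β : Fin m) :
    {K | adjCoeff P μ β K ≠ fun _ => 0}.Finite := by
  refine (P μ β).hasFiniteSupport.subset fun K hK h0 => hK ?_
  funext z
  simp [adjCoeff, h0, lift]

theorem isDifferential_adjCoeff {P : Fin m → Fin m → DiffOp n (Vars m mt)}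
    (hP : ∀ ν μ, (P ν μ).IsDifferential) (μ β : Fin m) (K : Fin n → ℕ) :
    IsDifferential (adjCoeff P μ β K) :=
  (isDifferential_w μ).mul (hP μ β K).lift

theorem exists_isLieBacklundExtension {P : Fin m → Fin m → DiffOp n (Vars m mt)}
    (hX : X.IsDifferential) (hP : ∀ ν μ, (P ν μ).IsDifferential) :
    ∃ es est, IsLieBacklundExtension X P es est := by
  -- Only the sum is prescribed, so `η*_β` can carry all of it with `η̃* = 0`.
  refine ⟨fun β z => -(w β z * lift (tdiv X.xi) z
      + ∑ μ, (P μ β).sum fun K a => (-1) ^ ord K * DD K (fun z => w μ z * lift a z) z),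
    fun _ _ => 0, fun β => ?_, fun _ => isDifferential_const 0, fun β z => by simp⟩
  refine (((isDifferential_w β).mul (isDifferential_tdiv hX.1).lift).add
    (IsDifferential.sum _ fun μ _ => ?_)).neg
  exact IsDifferential.sum _ fun K _ => ((isDifferential_adjCoeff hP μ β K).DD K).const_mul _

/-- What the extension leaves is `∑ (w^μ P_{μβ}(F_β) - P_{μβ}^*(w^μ) F_β)`, with `P^*` the formal
adjoint. Each summand is the divergence of the flux in which `F_β` plays the characteristic and `w^μ
λ^K_{μβ}` the coefficients. -/
theorem exists_isDivInvariant_of_isLieBacklundExtension (hF : ∀ α, IsDifferential (F α))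
    {P : Fin m → Fin m → DiffOp n (Vars m mt)} (hX : IsLieBacklundSymmetry F X P)
    (h : IsLieBacklundExtension X P es est) :
    ∃ B : Fin n → JetFn n (Vars2 m mt), (∀ i, IsDifferential (B i)) ∧
      IsDivInvariant (formalL F) (extend X es est) B := by
  have hd : ∀ q : Fin m × Fin m, ∀ i,
      IsDifferential (flux (lift (F q.2)) (adjCoeff P q.1 q.2) i) := fun q i =>
    (hF q.2).lift.flux (isDifferential_adjCoeff hX.2.1 q.1 q.2) (finite_adjCoeff P q.1 q.2) i
  refine ⟨fun i z => ∑ q : Fin m × Fin m, flux (lift (F q.2)) (adjCoeff P q.1 q.2) i z,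
    fun i => IsDifferential.sum _ fun q _ => hd q i, fun z => ?_⟩
  have h1 : ∀ μ β, (P μ β).sum (fun K a => (-1) ^ ord K * DD K (fun z => w μ z * lift a z) z)
      = ∑ᶠ K, (-1) ^ ord K * DD K (adjCoeff P μ β K) z := by
    intro μ β
    refine (finsum_eq_sum_of_support_subset _ fun K hK => ?_).symm
    by_contra hK'
    have h0 : P μ β K = 0 := by simpa using hK'
    have : adjCoeff P μ β K = fun _ => 0 := by
      funext z
      simp [adjCoeff, h0, lift]
    exact hK (mul_eq_zero_of_right _ (by
      change DD K (adjCoeff P μ β K) z = 0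
      rw [this, DD_zero_fun]))
  have h2 : ∀ μ β, w μ z * lift ((P μ β).app (F β)) z
      = ∑ᶠ K, DD K (lift (F β)) z * adjCoeff P μ β K z := by
    intro μ β
    rw [finsum_eq_sum_of_support_subset (s := (P μ β).support)]
    · simp only [lift, DiffOp.app, Finsupp.sum, Finset.mul_sum]
      refine Finset.sum_congr rfl fun K _ => ?_
      rw [DD_lift]
      simp only [adjCoeff, lift]
      ring
    · intro K hK
      by_contra hK'
      have h0 : P μ β K = 0 := by simpa using hK'
      exact hK (by simp [adjCoeff, h0, lift])
  have h3 : ∀ β, es β z + ∑ γ, est γ z + w β z * lift (tdiv X.xi) z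
      = -∑ μ, ∑ᶠ K, (-1) ^ ord K * DD K (adjCoeff P μ β K) z := by
    intro β
    rw [h.2.2 β z]
    simp only [h1]
    ring
  have h4 : ∀ β, w β z * lift (X.pr (F β)) z
      = ∑ μ, w β z * lift ((P β μ).app (F μ)) z := by
    intro β
    rw [← Finset.mul_sum]
    exact congrArg _ (hX.2.2 β (proj z))
  -- The sum over pairs is unfolded in opposite orders in its two parts: the outer index is that of
  -- `w` in the operator terms and that of `F` in the adjoint terms.
  rw [pr_extend_formalL_add hF, tdiv_sum _ fun q _ => hd q,
    Finset.sum_congr rfl fun (q : Fin m × Fin m) _ => tdiv_flux (hF q.2).lift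
      (isDifferential_adjCoeff hX.2.1 q.1 q.2) (finite_adjCoeff P q.1 q.2) z,
    Finset.sum_sub_distrib, Fintype.sum_prod_type, Fintype.sum_prod_type_right]
  simp only [h2, h3, h4, Finset.sum_add_distrib, neg_mul, Finset.sum_neg_distrib, Finset.sum_mul]
  rw [neg_add_eq_sub]
  simp only [mul_comm]

end

end Jets

end

theorem mainTheorem4 (n m mt : ℕ) (F : Fin m → JetFn n (Vars m mt))
    (hF : ∀ α, IsDifferential (F α)) (X : GenOp n (Vars m mt)) :
    -- Point symmetries
    (∀ lam : Fin m → Fin m → JetFn n (Vars m mt), IsPointSymmetry F X lam →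
      IsPointExtension X lam
        (fun β z => -((∑ α, w α z * lift (lam α β) z) + v β z * lift (tdiv X.xi) z))
        (fun γ z => -(vt γ z * lift (tdiv X.xi) z)) ∧
      ∀ es est, IsPointExtension X lam es est →
        IsDivInvariant (formalL F) (extend X es est) (fun _ _ => 0) ∧
        ∀ B : Fin n → JetFn n (Vars2 m mt), (∀ i, IsDifferential (B i)) →
          IsDivInvariant (formalL F) (extend X es est) B →
          IsConservedVector F (noether (formalL F) (extend X es est) B)) ∧
    -- Lie-Bäcklund symmetries
    (∀ P : Fin m → Fin m → DiffOp n (Vars m mt), IsLieBacklundSymmetry F X P →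
      (∃ es est, IsLieBacklundExtension X P es est) ∧
      ∀ es est, IsLieBacklundExtension X P es est →
        (∃ B : Fin n → JetFn n (Vars2 m mt), (∀ i, IsDifferential (B i)) ∧
          IsDivInvariant (formalL F) (extend X es est) B) ∧
        ∀ B : Fin n → JetFn n (Vars2 m mt), (∀ i, IsDifferential (B i)) →
          IsDivInvariant (formalL F) (extend X es est) B →
          IsConservedVector F (noether (formalL F) (extend X es est) B)) := by
  refine ⟨fun lam hX => ⟨isPointExtension_canonical hX.1 hX.2.2.1, fun es est h => ⟨?_, ?_⟩⟩,
    fun P hX => ⟨exists_isLieBacklundExtension hX.1 hX.2.1, fun es est h => ⟨?_, ?_⟩⟩⟩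
  · exact isDivInvariant_of_isPointExtension hF hX h
  · exact fun B hB hinv =>
      isConservedVector_noether hF (isDifferential_extend hX.1 h.1 h.2.1) hB hinv
  · exact exists_isDivInvariant_of_isLieBacklundExtension hF hX h
  · exact fun B hB hinv =>
      isConservedVector_noether hF (isDifferential_extend hX.1 h.1 h.2.1) hB hinv
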